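/- Let $N$ be a finite nonempty set of agents and $M$ a finite set of indivisible chores. For every agent $i\in N$ let $c_i:2^M\to\mathbb{R}_{\ge 0}$ be an additive cost function, i.e. $c_i(S)=\sum_{j\in S}c_i(\{j\})$ for all $S\subseteq M$ (so $c_i(\emptyset)=0$). An allocation is a partition $x=(x_i)_{i\in N}$ of $M$ into pairwise disjoint, possibly empty bundles $x_i\subseteq M$, one for each agent. A fractional allocation is a family $y=(y_{ij})_{i\in N,\,j\in M}$ with $y_{ij}\in[0,1]$ and $\sum_{i\in N}y_{ij}=1$ for every $j\in M$; its cost for agent $i$ is $c_i(y_i)=\sum_{j\in M}y_{ij}\,c_i(\{j\})$. Then there exists an allocation $x$ that has both of the following properties. 1. (Envy-freeness up to one chore, EF1.) For all $i,i'\in N$ with $c_i(x_i)>c_i(x_{i'})$ there is a chore $j\in x_i$ such that $c_i(x_i\setminus\{j\})\le c_i(x_{i'})$. 2. (Fractional Pareto optimality, fPO.) There is no fractional allocation $y$ such that $c_i(y_i)\le c_i(x_i)$ for every $i\in N$ and $c_{i'}(y_{i'})<c_{i'}(x_{i'})$ for some $i'\in N$. -/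

import Mathlib

namespace FairDivision

/-- A fair division instance with a set `N` of agents and a set `M` of indivisible chores: every
agent `i` has an additive cost function `cost i`, with nonnegative real values, on the sets of
chores. (Additivity for the empty set reads `cost i ∅ = 0`.) -/
structure ChoreInstance (N M : Type*) where
  cost : N → Finset M → ℝ
  cost_nonneg : ∀ i S, 0 ≤ cost i S
  cost_additive : ∀ i S, cost i S = ∑ j ∈ S, cost i {j}

/-- An (integral) allocation: a partition of the chores into one, possibly empty, bundle for each
agent. -/
structure Allocation (N M : Type*) where
  bundle : N → Finset M
  disjoint : ∀ i i', i ≠ i' → Disjoint (bundle i) (bundle i')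
  cover : ∀ j, ∃ i, j ∈ bundle i

/-- A fractional allocation: `share i j` is the fraction of chore `j` that agent `i` gets, and
every chore is completely distributed. -/
structure FractionalAllocation (N M : Type*) [Fintype N] where
  share : N → M → ℝ
  share_nonneg : ∀ i j, 0 ≤ share i j
  share_le_one : ∀ i j, share i j ≤ 1
  share_sum : ∀ j, ∑ i, share i j = 1

namespace ChoreInstance

variable {N M : Type*}

/-- The cost of agent `i` for her own part of the fractional allocation `y`. -/
def fractionalCost [Fintype N] [Fintype M] (I : ChoreInstance N M)
    (y : FractionalAllocation N M) (i : N) : ℝ :=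
  ∑ j, y.share i j * I.cost i {j}

/-- Agent `i` envies agent `i'`. -/
def Envies (I : ChoreInstance N M) (x : Allocation N M) (i i' : N) : Prop :=
  I.cost i (x.bundle i') < I.cost i (x.bundle i)

/-- Envy-freeness up to one chore. -/
def IsEF1 [DecidableEq M] (I : ChoreInstance N M) (x : Allocation N M) : Prop :=
  ∀ i i', I.Envies x i i' →
    ∃ j ∈ x.bundle i, I.cost i (x.bundle i \ {j}) ≤ I.cost i (x.bundle i')

/-- The allocation `x` is Pareto dominated by the fractional allocation `y`. -/
def IsDominatedBy [Fintype N] [Fintype M] (I : ChoreInstance N M)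
    (x : Allocation N M) (y : FractionalAllocation N M) : Prop :=
  (∀ i, I.fractionalCost y i ≤ I.cost i (x.bundle i)) ∧
    ∃ i, I.fractionalCost y i < I.cost i (x.bundle i)

/-- Fractional Pareto optimality of an (integral) allocation. -/
def IsFPO [Fintype N] [Fintype M] (I : ChoreInstance N M) (x : Allocation N M) : Prop :=
  ¬ ∃ y : FractionalAllocation N M, I.IsDominatedBy x y

end ChoreInstance

end FairDivision

/-!
The allocation is found together with weights `β i ≥ 0` of the agents and prices `P j` of the chores
such that `β i * P j ≤ c i j` always, with equality for the agent who gets `j`. The price of a bundle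
is what its owner earns. The inequalities make the allocation fractionally Pareto optimal, by weak
linear programming duality, and they turn envy-freeness up to one chore for the prices into
envy-freeness up to one chore for the costs. So the point is to choose weights for which an efficient
assignment (one that satisfies the equalities) is EF1 for the prices.

If all costs are positive, let `β` range over the standard simplex and let `1 / P j` be the maximum
of `β i / c i j`. The weights at which agent `i` earns least in some efficient assignment form a
closed set. These sets cover the simplex, and the `i`-th contains the facet `β i = 0`, because agent
`i` gets nothing there. By a covering theorem of KKM type (`exists_mem_forall_of_closed_cover`, proved
from Scarf's parity argument `exists_dominating_rainbow`), they have a common point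
(`exists_forall_least_earner`).

At a common point, consider the agent who has the largest total price `t` of chores that can go to
nobody else. Since she can be a least earner, some efficient assignment gives everyone at least `t`.
For generic costs the pairs (agent, chore) with equality form a forest (`dense_forest`). Root its
trees. As long as an agent has more than `t` after dropping any chore, she holds a chore which she
can pass to one of its child agents, and nobody falls below `t`. This ends with an assignment in
which everyone earns at least `t`, and at most `t` after dropping one chore
(`exists_priceEF1_of_forest`).

General positive costs follow by compactness of the simplex (`exists_efficient_priceEF1`), and chores
that cost nothing for some agent are given to such an agent at price zero (`exists_equilibrium`).
-/

/-! ### Scarf's lemma -/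

section Scarf

variable {V I L : Type*}

/-- A set `S` of points dominates, with respect to a family `u` of rankings indexed by `I`, if no
point is ranked strictly above the `u i`-minimum of `S` for all `i` simultaneously. -/
def Dominating [LinearOrder L] (u : I → V → L) (S : Finset V) : Prop :=
  ∀ v, ∃ i, ∀ s ∈ S, u i v ≤ u i s

theorem Dominating.mono [LinearOrder L] {u : I → V → L} {S T : Finset V} (hT : Dominating u T)
    (h : S ⊆ T) : Dominating u S := fun v =>
  let ⟨i, hi⟩ := hT v
  ⟨i, fun s hs => hi s (h hs)⟩

/-- In a dominating set every element is the minimum for some ranking. -/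
theorem Dominating.exists_argmin [LinearOrder L] {u : I → V → L}
    (hu : ∀ i, Function.Injective (u i)) {S : Finset V} (hS : Dominating u S) (hne : S.Nonempty) :
    ∃ φ : I → S, Function.Surjective φ ∧ ∀ i, ∀ s ∈ S, u i (φ i) ≤ u i s := by
  have h : ∀ i, ∃ a : S, ∀ s ∈ S, u i a ≤ u i s := fun i => by
    obtain ⟨a, ha, hmin⟩ := S.exists_min_image (u i) hne
    exact ⟨⟨a, ha⟩, hmin⟩
  choose φ hφ using h
  refine ⟨φ, fun s => ?_, hφ⟩
  obtain ⟨i, hi⟩ := hS s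
  exact ⟨i, Subtype.ext (hu i (le_antisymm (hφ i s s.2) (hi _ (φ i).2)))⟩

variable [DecidableEq V] [LinearOrder L]

open Classical in
/-- A dominating set with one element fewer than there are rankings lies in exactly two dominating
sets with one more element. Its minima coincide for exactly one pair of rankings `i ≠ i'`, and the
two new elements are the `u i`-best and the `u i'`-best among the points which lie above the minimum
in all other rankings. -/
theorem Dominating.card_completions [Fintype V] [Fintype I] {u : I → V → L}
    (hu : ∀ i, Function.Injective (u i)) {D : Finset V} (hD : Dominating u D) (hne : D.Nonempty) (hcard : D.card + 1 = Fintype.card I)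
    (hA : ∀ i, ∃ v, ∀ k, k ≠ i → ∃ s ∈ D, u k s < u k v) :
    (Finset.univ.filter fun v => v ∉ D ∧ Dominating u (insert v D)).card = 2 := by
  obtain ⟨φ, hφs, hφ⟩ := hD.exists_argmin hu hne
  have hninj : ¬ Function.Injective φ := fun hinj => by
    have := Fintype.card_of_bijective ⟨hinj, hφs⟩
    rw [Fintype.card_coe] at this
    omega
  obtain ⟨i, i', hφe, hii⟩ : ∃ i i', φ i = φ i' ∧ i ≠ i' := by
    simpa [Function.Injective] using hninj
  have hbest : ∀ i, ∃ v, (∀ k, k ≠ i → ∃ s ∈ D, u k s < u k v) ∧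
      ∀ w, (∀ k, k ≠ i → ∃ s ∈ D, u k s < u k w) → u i w ≤ u i v := fun i => by
    obtain ⟨v, hv, hmax⟩ := (Finset.univ.filter fun v => ∀ k, k ≠ i → ∃ s ∈ D, u k s < u k v)
      |>.exists_max_image (u i) (by obtain ⟨v, hv⟩ := hA i; exact ⟨v, by simpa using hv⟩)
    exact ⟨v, by simpa using hv, fun w hw => hmax w (by simpa using hw)⟩
  -- a point above all minima but the `l`-th is below the `l`-th one
  have hbelow : ∀ l v, (∀ k, k ≠ l → ∃ s ∈ D, u k s < u k v) → ∀ s ∈ D, u l v ≤ u l s := by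
    intro l v hv
    obtain ⟨k, hk⟩ := hD v
    by_cases hkl : k = l
    · exact hkl ▸ hk
    · obtain ⟨s, hs, hlt⟩ := hv k hkl
      exact absurd (hk s hs) (not_le.2 hlt)
  have hsuff : ∀ l l', l ≠ l' → φ l = φ l' → ∀ v, (∀ k, k ≠ l → ∃ s ∈ D, u k s < u k v) →
      (∀ w, (∀ k, k ≠ l → ∃ s ∈ D, u k s < u k w) → u l w ≤ u l v) →
      v ∉ D ∧ Dominating u (insert v D) := by
    intro l l' hll hφl v hv hmax
    constructor
    · intro hvD
      have h1 : v = φ l := hu l (le_antisymm (hbelow l v hv _ (φ l).2) (hφ l v hvD))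
      obtain ⟨s, hs, hlt⟩ := hv l' hll.symm
      rw [h1, hφl] at hlt
      exact absurd (hφ l' s hs) (not_le.2 hlt)
    · intro w
      by_cases hw : ∀ k, k ≠ l → ∃ s ∈ D, u k s < u k w
      · refine ⟨l, fun s hs => ?_⟩
        rcases Finset.mem_insert.1 hs with rfl | hs
        · exact hmax w hw
        · exact hbelow l w hw s hs
      · push Not at hw
        obtain ⟨k, hkl, hk⟩ := hw
        refine ⟨k, fun s hs => ?_⟩
        rcases Finset.mem_insert.1 hs with rfl | hs
        · obtain ⟨t, ht, hlt⟩ := hv k hkl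
          exact (hk t ht).trans hlt.le
        · exact hk s hs
  obtain ⟨a, haA, hamax⟩ := hbest i
  obtain ⟨b, hbA, hbmax⟩ := hbest i'
  have hab : a ≠ b := by
    rintro rfl
    obtain ⟨k, hk⟩ := hD a
    by_cases hki : k = i
    · obtain ⟨s, hs, hlt⟩ := hbA k (hki ▸ hii)
      exact absurd (hk s hs) (not_le.2 hlt)
    · obtain ⟨s, hs, hlt⟩ := haA k hki
      exact absurd (hk s hs) (not_le.2 hlt)
  rw [Finset.card_eq_two]
  refine ⟨a, b, hab, Finset.ext fun v => ?_⟩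
  simp only [Finset.mem_filter, Finset.mem_univ, true_and, Finset.mem_insert,
    Finset.mem_singleton]
  constructor
  · rintro ⟨hvD, hv⟩
    obtain ⟨ψ, hψs, hψ⟩ := hv.exists_argmin hu (Finset.insert_nonempty v D)
    have hψb : Function.Bijective ψ := (Fintype.bijective_iff_surjective_and_card ψ).2
      ⟨hψs, by rw [Fintype.card_coe, Finset.card_insert_of_notMem hvD, hcard]⟩
    obtain ⟨l, hl⟩ := hψs ⟨v, Finset.mem_insert_self v D⟩
    have hψD : ∀ k, k ≠ l → (ψ k : V) ∈ D := fun k hk => by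
      refine (Finset.mem_insert.1 (ψ k).2).resolve_left fun h => hk (hψb.1 ?_)
      rw [hl]
      exact Subtype.ext h
    have hψφ : ∀ k, k ≠ l → (ψ k : V) = φ k := fun k hk =>
      hu k (le_antisymm (hψ k _ (Finset.mem_insert_of_mem (φ k).2)) (hφ k _ (hψD k hk)))
    have hvA : ∀ k, k ≠ l → ∃ s ∈ D, u k s < u k v := fun k hk =>
      ⟨ψ k, hψD k hk, lt_of_le_of_ne (hψ k v (Finset.mem_insert_self v D))
        fun h => hvD (hu k h ▸ hψD k hk)⟩
    have hvmax : ∀ w, (∀ k, k ≠ l → ∃ s ∈ D, u k s < u k w) → u l w ≤ u l v := by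
      intro w hw
      obtain ⟨k, hk⟩ := hv w
      by_cases hkl : k = l
      · exact hkl ▸ hk v (Finset.mem_insert_self v D)
      · obtain ⟨s, hs, hlt⟩ := hw k hkl
        exact absurd (hk s (Finset.mem_insert_of_mem hs)) (not_le.2 hlt)
    by_cases hli : l = i
    · subst hli
      exact Or.inl (hu l (le_antisymm (hamax v hvA) (hvmax a haA)))
    by_cases hli' : l = i'
    · subst hli'
      exact Or.inr (hu l (le_antisymm (hbmax v hvA) (hvmax b hbA)))
    refine absurd (hψb.1 (Subtype.ext ?_)) hii
    rw [hψφ i (Ne.symm hli), hψφ i' (Ne.symm hli'), hφe]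
  · rintro (rfl | rfl)
    · exact hsuff i i' hii hφe _ haA hamax
    · exact hsuff i' i hii.symm hφe.symm _ hbA hbmax

open Classical in
/-- The completions of a set to a set with one more element correspond to the added elements. -/
theorem card_dominating_supersets [Fintype V] (u : I → V → L) (D : Finset V) :
    (Finset.univ.filter fun S : Finset V => (S.card = D.card + 1 ∧ Dominating u S) ∧ D ⊆ S).card =
      (Finset.univ.filter fun v => v ∉ D ∧ Dominating u (insert v D)).card := by
  symm
  refine Finset.card_bij (fun v _ => insert v D) ?_ ?_ ?_
  · intro v hv
    simp only [Finset.mem_filter, Finset.mem_univ, true_and] at hv ⊢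
    exact ⟨⟨Finset.card_insert_of_notMem hv.1, hv.2⟩, Finset.subset_insert v D⟩
  · intro v hv w hw h
    simp only [Finset.mem_filter, Finset.mem_univ, true_and] at hv hw
    have : v ∈ insert w D := h ▸ Finset.mem_insert_self v D
    exact (Finset.mem_insert.1 this).resolve_right hv.1
  · intro S hS
    simp only [Finset.mem_filter, Finset.mem_univ, true_and] at hS
    obtain ⟨⟨hc, hd⟩, hsub⟩ := hS
    obtain ⟨v, hv, rfl⟩ : ∃ v, v ∉ D ∧ insert v D = S :=
      (Finset.covBy_iff_card_sdiff_eq_one.2 ⟨hsub, by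
        rw [Finset.card_sdiff_of_subset hsub, hc]; omega⟩).exists_finset_insert
    exact ⟨v, by simpa using ⟨hv, hd⟩, rfl⟩

open Classical in
/-- A set whose colours are not all of `I` has an even number (zero or two) of subsets with one
element fewer that show exactly the colours other than `i₀`. -/
theorem even_card_doors [Fintype I] [DecidableEq I] (c : V → I) (i₀ : I) {S : Finset V}
    (hcard : S.card = Fintype.card I)
    (hS : S.image c ≠ Finset.univ) :
    Even (S.filter fun s => (S.erase s).image c = Finset.univ.erase i₀).card := by
  by_cases h : ∃ s ∈ S, (S.erase s).image c = Finset.univ.erase i₀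
  · obtain ⟨s, hs, hsc⟩ := h
    have hcs : c s ≠ i₀ := by
      intro h
      apply hS
      rw [← Finset.insert_erase hs, Finset.image_insert, hsc, h,
        Finset.insert_erase (Finset.mem_univ i₀)]
    have hinj : Set.InjOn c (S.erase s) := by
      apply Finset.injOn_of_card_image_eq
      rw [hsc, Finset.card_erase_of_mem hs, Finset.card_erase_of_mem (Finset.mem_univ _), hcard,
        Finset.card_univ]
    obtain ⟨s', hs', hcc⟩ : ∃ s' ∈ S.erase s, c s' = c s := by
      have : c s ∈ (S.erase s).image c := by rw [hsc]; simp [hcs]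
      simpa using this
    have hne := Finset.ne_of_mem_erase hs'
    have key : (S.filter fun s => (S.erase s).image c = Finset.univ.erase i₀) = {s, s'} := by
      ext t
      simp only [Finset.mem_filter, Finset.mem_insert, Finset.mem_singleton]
      constructor
      · rintro ⟨htS, ht⟩
        by_contra! hts
        have hct : c t ≠ i₀ := by
          have : c t ∈ (S.erase s).image c :=
            Finset.mem_image_of_mem c (Finset.mem_erase.2 ⟨hts.1, htS⟩)
          rw [hsc] at this
          simpa using this
        have : c t ∈ (S.erase t).image c := by rw [ht]; simp [hct]
        obtain ⟨r, hr, hrt⟩ := Finset.mem_image.1 this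
        have hrt' := Finset.mem_erase.1 hr
        have htm : t ∈ S.erase s := Finset.mem_erase.2 ⟨hts.1, htS⟩
        by_cases hrs : r = s
        · subst hrs
          exact hts.2 (hinj htm hs' (by rw [hcc, hrt]))
        · exact hrt'.1 (hinj (Finset.mem_erase.2 ⟨hrs, hrt'.2⟩) htm hrt)
      · rintro (rfl | rfl)
        · exact ⟨hs, hsc⟩
        · have hs'S := Finset.mem_of_mem_erase hs'
          refine ⟨hs'S, ?_⟩
          rw [← hsc]
          have e1 : S.erase t = insert s ((S.erase s).erase t) := by
            rw [Finset.erase_right_comm, Finset.insert_erase (Finset.mem_erase.2 ⟨hne.symm, hs⟩)]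
          rw [e1, Finset.image_insert, ← hcc, ← Finset.image_insert, Finset.insert_erase hs']
    rw [key, Finset.card_pair hne.symm]
    exact even_two
  · rw [Finset.filter_eq_empty_iff.2 fun s hs hsc => h ⟨s, hs, hsc⟩]
    simp

open Classical in
/-- **Scarf's lemma**, a combinatorial form of Sperner's lemma. Let each ranking `u i` have a
"slack" point `σ i` at the bottom and the other slack points at the top. If the points are coloured
by `I`, with `σ i` in colour `i`, then there is a dominating set in which every colour occurs exactly
once. -/
theorem exists_dominating_rainbow [Fintype V] [Fintype I] [DecidableEq I] {u : I → V → L}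
    (hu : ∀ i, Function.Injective (u i)) (σ : I → V)
    (hbot : ∀ i v, u i (σ i) ≤ u i v)
    (htop : ∀ i k v, k ≠ i → v ∉ Set.range σ → u i v < u i (σ k))
    (c : V → I) (hc : ∀ i, c (σ i) = i) [Nonempty I] :
    ∃ S : Finset V, S.card = Fintype.card I ∧ Dominating u S ∧ S.image c = Finset.univ := by
  by_contra! hno
  obtain ⟨i₀⟩ := ‹Nonempty I›
  have hσ : Function.Injective σ := fun a b h => by rw [← hc a, h, hc]
  have hpos : 0 < Fintype.card I := Fintype.card_pos_iff.2 ⟨i₀⟩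
  set rooms := Finset.univ.filter fun S : Finset V => S.card = Fintype.card I ∧ Dominating u S
    with hrooms
  set doors := Finset.univ.filter fun D : Finset V =>
    D.card + 1 = Fintype.card I ∧ Dominating u D ∧ D.image c = Finset.univ.erase i₀ with hdoors
  have hdc := Finset.sum_card_bipartiteAbove_eq_sum_card_bipartiteBelow
    (s := doors) (t := rooms) (fun D S => D ⊆ S)
  -- every room has an even number of doors
  have hR : Even (∑ S ∈ rooms, (Finset.bipartiteBelow (fun D S => D ⊆ S) doors S).card) := by
    refine Finset.even_sum _ fun S hS => ?_
    obtain ⟨hcard, hdom⟩ := (Finset.mem_filter.1 hS).2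
    have := even_card_doors c i₀ hcard (hno S hcard hdom)
    rw [show (Finset.bipartiteBelow (fun D S => D ⊆ S) doors S).card =
      (S.filter fun s => (S.erase s).image c = Finset.univ.erase i₀).card from ?_]
    · exact this
    symm
    refine Finset.card_bij (fun s _ => S.erase s) ?_ ?_ ?_
    · intro s hs
      obtain ⟨hs, hsc⟩ := Finset.mem_filter.1 hs
      simp only [Finset.bipartiteBelow, hdoors, Finset.mem_filter, Finset.mem_univ, true_and]
      exact ⟨⟨by rw [Finset.card_erase_of_mem hs]; omega, hdom.mono (Finset.erase_subset _ _), hsc⟩,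
        Finset.erase_subset _ _⟩
    · intro s hs t ht h
      exact (Finset.erase_inj S (Finset.mem_filter.1 hs).1).1 h
    · intro D hD
      simp only [Finset.bipartiteBelow, hdoors, Finset.mem_filter, Finset.mem_univ, true_and] at hD
      obtain ⟨⟨hDc, -, hDi⟩, hsub⟩ := hD
      obtain ⟨v, hv, hvS⟩ : ∃ v, v ∉ D ∧ insert v D = S :=
        (Finset.covBy_iff_card_sdiff_eq_one.2 ⟨hsub, by
          rw [Finset.card_sdiff_of_subset hsub]; omega⟩).exists_finset_insert
      have he : S.erase v = D := by rw [← hvS, Finset.erase_insert hv]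
      exact ⟨v, Finset.mem_filter.2 ⟨hvS ▸ Finset.mem_insert_self v D, by rw [he, hDi]⟩, he⟩
  -- the door made of slack points lies in one room, all the others in two
  set D₀ := (Finset.univ.erase i₀).image σ with hD₀
  have hmem₀ : ∀ v, v ∈ D₀ ↔ ∃ k, k ≠ i₀ ∧ σ k = v := by simp [hD₀]
  have hlow : ∀ w, w ∉ D₀ → ∀ s ∈ D₀, u i₀ w ≤ u i₀ s := by
    intro w hw s hs
    obtain ⟨k, hk, rfl⟩ := (hmem₀ s).1 hs
    by_cases hr : w ∈ Set.range σ
    · obtain ⟨m, rfl⟩ := hr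
      by_cases hm : m = i₀
      · exact hm ▸ hbot i₀ _
      · exact absurd ((hmem₀ _).2 ⟨m, hm, rfl⟩) hw
    · exact (htop i₀ k w hk hr).le
  have hD₀mem : D₀ ∈ doors := by
    simp only [hdoors, Finset.mem_filter, Finset.mem_univ, true_and]
    refine ⟨?_, fun v => ?_, ?_⟩
    · rw [hD₀, Finset.card_image_of_injective _ hσ, Finset.card_erase_of_mem (Finset.mem_univ _),
        Finset.card_univ]
      omega
    · by_cases hv : v ∈ D₀
      · obtain ⟨k, hk, rfl⟩ := (hmem₀ v).1 hv
        exact ⟨k, fun s _ => hbot k s⟩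
      · exact ⟨i₀, hlow v hv⟩
    · rw [hD₀, Finset.image_image, show c ∘ σ = id from funext hc, Finset.image_id]
  have hcount : ∀ D ∈ doors, (Finset.bipartiteAbove (fun D S => D ⊆ S) rooms D).card =
      (Finset.univ.filter fun v => v ∉ D ∧ Dominating u (insert v D)).card := by
    intro D hD
    rw [← card_dominating_supersets, Finset.bipartiteAbove, hrooms, Finset.filter_filter,
      (Finset.mem_filter.1 hD).2.1]
  have h₀ : (Finset.bipartiteAbove (fun D S => D ⊆ S) rooms D₀).card = 1 := by
    rw [hcount D₀ hD₀mem]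
    obtain ⟨a, ha, hmax⟩ := (Finset.univ.filter fun v => v ∉ D₀).exists_max_image (u i₀)
      ⟨σ i₀, by
        simp only [Finset.mem_filter, Finset.mem_univ, true_and, hmem₀, not_exists, not_and]
        exact fun k hk h => hk (hσ h)⟩
    simp only [Finset.mem_filter, Finset.mem_univ, true_and] at ha hmax
    rw [Finset.card_eq_one]
    refine ⟨a, Finset.ext fun v => ?_⟩
    simp only [Finset.mem_filter, Finset.mem_univ, true_and, Finset.mem_singleton]
    constructor
    · rintro ⟨hv, hdom⟩
      refine hu i₀ (le_antisymm (hmax v hv) ?_)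
      obtain ⟨k, hk⟩ := hdom a
      by_cases hki : k = i₀
      · exact hki ▸ hk v (Finset.mem_insert_self v D₀)
      · have hkD : σ k ∈ D₀ := (hmem₀ _).2 ⟨k, hki, rfl⟩
        have : a = σ k :=
          hu k (le_antisymm (hk _ (Finset.mem_insert_of_mem hkD)) (hbot k a))
        exact absurd (this ▸ hkD) ha
    · rintro rfl
      refine ⟨ha, fun w => ?_⟩
      by_cases hw : w ∈ D₀
      · obtain ⟨k, hk, rfl⟩ := (hmem₀ w).1 hw
        exact ⟨k, fun s _ => hbot k s⟩
      · refine ⟨i₀, fun s hs => ?_⟩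
        rcases Finset.mem_insert.1 hs with rfl | hs
        · exact hmax w hw
        · exact hlow w hw s hs
  have h₂ : ∀ D ∈ doors.erase D₀,
      (Finset.bipartiteAbove (fun D S => D ⊆ S) rooms D).card = 2 := by
    intro D hD
    obtain ⟨hne, hD⟩ := Finset.mem_erase.1 hD
    rw [hcount D hD]
    obtain ⟨hcard, hdom, hcol⟩ := (Finset.mem_filter.1 hD).2
    obtain ⟨x, hxD, hx⟩ : ∃ x ∈ D, x ∉ Set.range σ := by
      by_contra! hall
      refine hne (Finset.eq_of_subset_of_card_le (fun v hv => ?_) ?_)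
      · obtain ⟨k, rfl⟩ := hall v hv
        refine (hmem₀ _).2 ⟨k, ?_, rfl⟩
        have : c (σ k) ∈ D.image c := Finset.mem_image_of_mem c hv
        rw [hcol, hc] at this
        exact Finset.ne_of_mem_erase this
      · have := (Finset.mem_filter.1 hD₀mem).2.1
        omega
    exact hdom.card_completions hu ⟨x, hxD⟩ hcard fun i =>
      ⟨σ i, fun k hk => ⟨x, hxD, htop k i x hk.symm hx⟩⟩
  rw [← Finset.add_sum_erase _ _ hD₀mem, h₀, Finset.sum_congr rfl h₂, Finset.sum_const] at hdc
  rw [← hdc, smul_eq_mul, mul_comm] at hR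
  exact absurd hR (by rw [Nat.not_even_iff_odd]; exact ⟨_, add_comm _ _⟩)

end Scarf

/-! ### Closed covers of the simplex -/

section Covering

open Filter Topology

variable {I : Type*} [Fintype I]

/-- The points with denominator `N` of the standard simplex, scaled by `N`. -/
abbrev GridPoint (I : Type*) [Fintype I] (N : ℕ) : Type _ := {a : I → ℕ // ∑ i, a i = N}

/-- The ranking of grid points `a : I → ℕ` by their `i`-th coordinate, extended to slack points. -/
def gridRank [DecidableEq I] (N : ℕ) (i : I) : GridPoint I N ⊕ I → ℤ
  | Sum.inl a => a.1 i
  | Sum.inr k => if k = i then -1 else N + 1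

/-- Scarf's lemma for the points with denominator `N` of the simplex: for every colouring of them
there is a small cluster which shows all the colours except some `i` with a small `i`-th coordinate. -/
theorem exists_grid_cluster [Nonempty I] (N : ℕ)
    (c : GridPoint I N → I) :
    ∃ b : GridPoint I N, ∀ i, b.1 i < Fintype.card I ∨
      ∃ t, c t = i ∧ ∀ k, t.1 k < b.1 k + Fintype.card I ∧ b.1 k < t.1 k + Fintype.card I := by
  classical
  have : Finite (GridPoint I N) := Set.Finite.to_subtype <|
    ((Finset.piAntidiag (Finset.univ : Finset I) N).finite_toSet.subset fun a ha => by
      rw [Finset.mem_coe, Finset.mem_piAntidiag]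
      exact ⟨ha, fun i _ => Finset.mem_univ i⟩)
  have : Fintype (GridPoint I N) := Fintype.ofFinite _
  have hle : ∀ (a : GridPoint I N) i, a.1 i ≤ N := fun a i => by
    have := Finset.single_le_sum (f := a.1) (fun _ _ => Nat.zero_le _) (Finset.mem_univ i)
    rwa [a.2] at this
  set r : I → GridPoint I N ⊕ I → ℤ := gridRank N with hr
  have hrl : ∀ i (a : GridPoint I N), r i (Sum.inl a) = a.1 i := fun _ _ => rfl
  have hrs : ∀ i, r i (Sum.inr i) = -1 := fun i => by simp [hr, gridRank]
  have hrn : ∀ i k, k ≠ i → r i (Sum.inr k) = N + 1 := fun i k h => by simp [hr, gridRank, h]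
  -- ties between equal coordinates are broken by an arbitrary enumeration of the points
  set e := Fintype.equivFin (GridPoint I N ⊕ I)
  set u : I → GridPoint I N ⊕ I → ℤ ×ₗ Fin (Fintype.card (GridPoint I N ⊕ I)) :=
    fun i v => toLex (r i v, e v) with hu
  have hlt : ∀ i v w, r i v < r i w → u i v < u i w := fun i v w h =>
    Prod.Lex.toLex_lt_toLex.2 (Or.inl h)
  have hule : ∀ i v w, u i v ≤ u i w → r i v ≤ r i w := fun i v w h => by
    by_contra! hn
    exact absurd h (not_le.2 (hlt i w v hn))
  obtain ⟨S, -, hdom, hcol⟩ := exists_dominating_rainbow (u := u)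
    (fun i v w h => e.injective (congrArg (fun x => (ofLex x).2) h)) Sum.inr
    (by
      rintro i (a | k)
      · exact (hlt _ _ _ (by rw [hrs, hrl]; omega)).le
      · by_cases h : k = i
        · rw [h]
        · exact (hlt _ _ _ (by rw [hrs, hrn i k h]; omega)).le)
    (by
      rintro i k (a | m) hk hv
      · exact hlt _ _ _ (by rw [hrl, hrn i k hk]; have := hle a i; omega)
      · exact absurd ⟨m, rfl⟩ hv)
    (Sum.elim c id) (fun i => rfl)
  replace hdom : ∀ v, ∃ i, ∀ s ∈ S, r i v ≤ r i s := fun v => by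
    obtain ⟨i, hi⟩ := hdom v
    exact ⟨i, fun s hs => hule i v s (hi s hs)⟩
  obtain ⟨i₀⟩ := ‹Nonempty I›
  -- a grid point can only be dominated in a direction whose slack point is not in `S`
  have hgrid : ∀ a : GridPoint I N,
      ∃ i, Sum.inr i ∉ S ∧ ∀ t, Sum.inl t ∈ S → a.1 i ≤ t.1 i := fun a => by
    obtain ⟨i, hi⟩ := hdom (Sum.inl a)
    refine ⟨i, fun h => ?_, fun t ht => ?_⟩
    · have := hi _ h
      rw [hrl, hrs] at this
      omega
    · have := hi _ ht
      rw [hrl, hrl] at this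
      omega
  set C := Finset.univ.filter fun i => Sum.inr i ∉ S with hC
  have hcol' : ∀ i ∈ C, ∃ t, Sum.inl t ∈ S ∧ c t = i := fun i hi => by
    have : i ∈ S.image (Sum.elim c id) := hcol ▸ Finset.mem_univ i
    obtain ⟨v, hv, hvi⟩ := Finset.mem_image.1 this
    rcases v with t | k
    · exact ⟨t, hv, hvi⟩
    · simp only [Sum.elim_inr, id] at hvi
      exact absurd (hvi ▸ hv) (by simpa [hC] using hi)
  obtain ⟨j₀, hj₀, -⟩ := hgrid ⟨Pi.single i₀ N, by simp⟩
  have hj₀C : j₀ ∈ C := by simpa [hC] using hj₀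
  obtain ⟨b, hb, -⟩ := hcol' j₀ hj₀C
  have hmin : ∀ i, ∃ m : GridPoint I N, Sum.inl m ∈ S ∧ ∀ t, Sum.inl t ∈ S → m.1 i ≤ t.1 i := fun i => by
    obtain ⟨m, hm, hmm⟩ := (Finset.univ.filter fun t : GridPoint I N => Sum.inl t ∈ S).exists_min_image
      (fun t => t.1 i) ⟨b, by simpa using hb⟩
    exact ⟨m, by simpa using hm, fun t ht => hmm t (by simpa using ht)⟩
  choose m hmS hm using hmin
  -- the minimal coordinates nearly exhaust the total `N`
  have hsum : N < ∑ i ∈ C, ((m i).1 i + 1) := by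
    by_contra! hcon
    set d := N - ∑ i ∈ C, ((m i).1 i + 1) with hd
    set a : I → ℕ := fun i => (if i ∈ C then (m i).1 i + 1 else 0) + if i = j₀ then d else 0 with ha
    have hasum : ∑ i, a i = N := by
      rw [ha, Finset.sum_add_distrib]
      simp only [Finset.sum_ite_mem, Finset.univ_inter, Finset.sum_ite_eq', Finset.mem_univ,
        if_true]
      omega
    obtain ⟨i, hi, hi'⟩ := hgrid ⟨a, hasum⟩
    have hiC : i ∈ C := by simpa [hC] using hi
    have := hi' _ (hmS i)
    simp only [ha, hiC, if_true] at this
    omega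
  have hsum' : N < (∑ i ∈ C, (m i).1 i) + Fintype.card I := by
    rw [Finset.sum_add_distrib, Finset.sum_const, smul_eq_mul, mul_one] at hsum
    have := C.card_le_univ
    omega
  have hout : ∀ t : GridPoint I N, Sum.inl t ∈ S → ∀ i, i ∉ C → t.1 i < Fintype.card I := by
    intro t ht i hi
    have h1 : ∑ k ∈ insert i C, t.1 k ≤ N := by
      refine le_of_le_of_eq ?_ t.2
      exact Finset.sum_le_sum_of_subset (Finset.subset_univ _)
    rw [Finset.sum_insert hi] at h1
    have h2 : ∑ k ∈ C, (m k).1 k ≤ ∑ k ∈ C, t.1 k := Finset.sum_le_sum fun k _ => hm k t ht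
    omega
  have hin : ∀ t : GridPoint I N, Sum.inl t ∈ S → ∀ i ∈ C, t.1 i < (m i).1 i + Fintype.card I := by
    intro t ht i hi
    have h1 : ∑ k ∈ C, t.1 k ≤ N := by
      refine le_of_le_of_eq ?_ t.2
      exact Finset.sum_le_sum_of_subset (Finset.subset_univ _)
    have h2 : ∑ k ∈ C.erase i, (m k).1 k ≤ ∑ k ∈ C.erase i, t.1 k :=
      Finset.sum_le_sum fun k _ => hm k t ht
    rw [← Finset.add_sum_erase _ _ hi] at h1 hsum'
    omega
  refine ⟨b, fun i => ?_⟩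
  by_cases hi : i ∈ C
  · obtain ⟨t, ht, hti⟩ := hcol' i hi
    refine Or.inr ⟨t, hti, fun k => ?_⟩
    by_cases hk : k ∈ C
    · have h1 := hin t ht k hk
      have h2 := hin b hb k hk
      have h3 := hm k t ht
      have h4 := hm k b hb
      omega
    · have h1 := hout t ht k hk
      have h2 := hout b hb k hk
      omega
  · exact Or.inl (hout b hb i hi)

/-- A **KKM theorem** (in Sperner's dual form): closed sets `F i` which cover the simplex and such
that `F i` contains the facet where the `i`-th coordinate vanishes have a common point. -/
theorem exists_mem_forall_of_closed_cover [Nonempty I] (F : I → Set (stdSimplex ℝ I))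
    (hF : ∀ i, IsClosed (F i)) (hcov : ∀ b, ∃ i, b ∈ F i)
    (hface : ∀ i, ∀ b : stdSimplex ℝ I, b.1 i = 0 → b ∈ F i) :
    ∃ b, ∀ i, b ∈ F i := by
  set n : ℝ := (Fintype.card I : ℝ) with hn
  -- points of the simplex that nearly satisfy the conclusion
  have happrox : ∀ N : ℕ, ∃ b : stdSimplex ℝ I, ∀ i, b.1 i ≤ n / (N + 1 : ℕ) ∨
      ∃ t ∈ F i, dist t b ≤ n / (N + 1 : ℕ) := by
    intro N
    have hN : (0 : ℝ) < (N + 1 : ℕ) := by positivity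
    set pt : GridPoint I (N + 1) → stdSimplex ℝ I := fun a =>
      ⟨fun i => a.1 i / (N + 1 : ℕ), fun i => by positivity, by
        rw [← Finset.sum_div, ← Nat.cast_sum, a.2, div_self hN.ne']⟩ with hpt
    choose c hc using fun a => hcov (pt a)
    obtain ⟨b, hb⟩ := exists_grid_cluster (N + 1) c
    refine ⟨pt b, fun i => ?_⟩
    rcases hb i with h | ⟨t, ht, htb⟩
    · left
      have : ((b.1 i : ℕ) : ℝ) ≤ n := by rw [hn]; exact_mod_cast h.le
      exact div_le_div_of_nonneg_right this hN.le
    · refine Or.inr ⟨pt t, ht ▸ hc t, ?_⟩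
      rw [Subtype.dist_eq, dist_pi_le_iff (by positivity)]
      intro k
      obtain ⟨h1, h2⟩ := htb k
      have h1' : ((t.1 k : ℕ) : ℝ) ≤ b.1 k + n := by rw [hn]; exact_mod_cast h1.le
      have h2' : ((b.1 k : ℕ) : ℝ) ≤ t.1 k + n := by rw [hn]; exact_mod_cast h2.le
      rw [Real.dist_eq, hpt, ← sub_div, abs_div, abs_of_pos hN]
      exact div_le_div_of_nonneg_right (abs_le.2 ⟨by linarith, by linarith⟩) hN.le
  choose b hbF using happrox
  obtain ⟨β, φ, hφ, hlim⟩ := CompactSpace.tendsto_subseq b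
  refine ⟨β, fun i => ?_⟩
  by_contra hi
  have hpos : 0 < β.1 i := lt_of_le_of_ne (β.2.1 i) fun h => hi (hface i β h.symm)
  obtain ⟨ε, hε, hball⟩ := Metric.isOpen_iff.1 (hF i).isOpen_compl β hi
  have hsmall : Tendsto (fun N : ℕ => n / ((φ N + 1 : ℕ) : ℝ)) atTop (𝓝 0) :=
    (tendsto_const_div_atTop_nhds_zero_nat n).comp
      ((tendsto_add_atTop_nat 1).comp hφ.tendsto_atTop)
  have hlimi : Tendsto (fun N => (b (φ N)).1 i) atTop (𝓝 (β.1 i)) :=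
    (((continuous_apply i).comp continuous_subtype_val).tendsto β).comp hlim
  obtain ⟨N, hN1, hN2, hN3, hN4⟩ := ((hsmall.eventually (gt_mem_nhds (half_pos hpos))).and
    ((hsmall.eventually (gt_mem_nhds (half_pos hε))).and
    ((hlimi.eventually (lt_mem_nhds (half_lt_self hpos))).and
    (hlim.eventually (Metric.ball_mem_nhds β (half_pos hε)))))).exists
  rcases hbF (φ N) i with h | ⟨t, ht, htb⟩
  · linarith
  · refine hball (Metric.mem_ball.2 ?_) ht
    have hN4' : dist (b (φ N)) β < ε / 2 := hN4
    calc dist t β ≤ dist t (b (φ N)) + dist (b (φ N)) β := dist_triangle _ _ _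
      _ < ε := by linarith

end Covering

/-! ### Forests in bipartite graphs -/

section Forest

variable {N M : Type*} [DecidableEq N] [DecidableEq M]

/-- A bipartite graph, given by its set of edges, is leafless if no edge ends in a vertex of
degree one. -/
def Leafless (E : Finset (N × M)) : Prop :=
  ∀ e ∈ E, (∃ e' ∈ E, e' ≠ e ∧ e'.1 = e.1) ∧ ∃ e' ∈ E, e' ≠ e ∧ e'.2 = e.2

/-- A bipartite graph without nonempty leafless subgraphs (a forest) has a set `D` of edges
such that every vertex in `N` is in at most one edge of `D` and every vertex in `M` in at most one
edge outside `D`: after rooting each tree, `D` joins every vertex in `N` to its parent. -/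
theorem exists_parent_edges (E : Finset (N × M))
    (hE : ∀ E' ⊆ E, E'.Nonempty → ¬ Leafless E') :
    ∃ D ⊆ E, (∀ e ∈ D, ∀ e' ∈ D, e.1 = e'.1 → e = e') ∧
      ∀ e ∈ E, e ∉ D → ∀ e' ∈ E, e' ∉ D → e.2 = e'.2 → e = e' := by
  induction E using Finset.strongInduction with
  | H E ih =>
    rcases E.eq_empty_or_nonempty with rfl | hne
    · exact ⟨∅, by simp⟩
    have := hE E subset_rfl hne
    simp only [Leafless, not_forall] at this
    obtain ⟨e, he, hleaf⟩ := this
    obtain ⟨D, hDE, hD1, hD2⟩ := ih (E.erase e) (Finset.erase_ssubset he)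
      fun E' hE' => hE E' (hE'.trans (Finset.erase_subset _ _))
    have heD : e ∉ D := fun h => absurd (hDE h) (Finset.notMem_erase e E)
    by_cases h1 : ∃ e' ∈ E, e' ≠ e ∧ e'.1 = e.1
    · have h2 : ∀ e' ∈ E, e'.2 = e.2 → e' = e := by
        by_contra! h
        obtain ⟨e', a, b, c⟩ := h
        exact hleaf ⟨h1, e', a, c, b⟩
      refine ⟨D, hDE.trans (Finset.erase_subset _ _), hD1, fun a ha haD b hb hbD hab => ?_⟩
      by_cases hae : a = e
      · subst hae
        exact (h2 b hb hab.symm).symm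
      by_cases hbe : b = e
      · subst hbe
        exact h2 a ha hab
      exact hD2 a (Finset.mem_erase.2 ⟨hae, ha⟩) haD b (Finset.mem_erase.2 ⟨hbe, hb⟩) hbD hab
    · push Not at h1
      have h1' : ∀ e' ∈ E, e'.1 = e.1 → e' = e := fun e' he' h => by
        by_contra hn
        exact h1 e' he' hn h
      refine ⟨insert e D, Finset.insert_subset he (hDE.trans (Finset.erase_subset _ _)), ?_, ?_⟩
      · intro a ha b hb hab
        have hs : ∀ a ∈ insert e D, a ∈ E := fun a ha => (Finset.mem_insert.1 ha).elim
          (fun h => h ▸ he) fun h => Finset.mem_of_mem_erase (hDE h)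
        rcases Finset.mem_insert.1 ha with rfl | ha'
        · exact (h1' b (hs b hb) hab.symm).symm
        rcases Finset.mem_insert.1 hb with rfl | hb'
        · exact h1' a (hs a ha) hab
        exact hD1 a ha' b hb' hab
      · intro a ha haD b hb hbD hab
        rw [Finset.mem_insert, not_or] at haD hbD
        exact hD2 a (Finset.mem_erase.2 ⟨haD.1, ha⟩) haD.2 b (Finset.mem_erase.2 ⟨hbD.1, hb⟩)
          hbD.2 hab

/-- A nonempty leafless bipartite graph has at least as many edges as vertices. Hence it carries a
nonzero real weighting of its edges which sums to zero around each vertex. -/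
theorem Leafless.exists_circulation [Fintype N] [Fintype M] {E : Finset (N × M)} (hE : Leafless E)
    (hne : E.Nonempty) :
    ∃ z : N × M → ℝ, z ≠ 0 ∧ (∀ e, e ∉ E → z e = 0) ∧ (∀ i, ∑ j, z (i, j) = 0) ∧
      ∀ j, ∑ i, z (i, j) = 0 := by
  obtain ⟨e₀, he₀⟩ := hne
  have hA : 2 * (E.image Prod.fst).card ≤ E.card := by
    refine Finset.mul_card_image_le_card E 2 fun i hi => ?_
    obtain ⟨e, he, rfl⟩ := Finset.mem_image.1 hi
    obtain ⟨e', he', hne, heq⟩ := (hE e he).1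
    exact Finset.one_lt_card.2 ⟨e, by simp [he], e', by simp [he', heq], hne.symm⟩
  have hB : 2 * (E.image Prod.snd).card ≤ E.card := by
    refine Finset.mul_card_image_le_card E 2 fun i hi => ?_
    obtain ⟨e, he, rfl⟩ := Finset.mem_image.1 hi
    obtain ⟨e', he', hne, heq⟩ := (hE e he).2
    exact Finset.one_lt_card.2 ⟨e, by simp [he], e', by simp [he', heq], hne.symm⟩
  -- the equation at one vertex follows from the others, which leaves fewer equations than edges
  set A := (E.image Prod.fst).erase e₀.1 with hAdef
  have hAcard : A.card + 1 = (E.image Prod.fst).card :=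
    Finset.card_erase_add_one (Finset.mem_image_of_mem _ he₀)
  let ext : (E → ℝ) →ₗ[ℝ] (N × M → ℝ) :=
    { toFun := fun w e => if h : e ∈ E then w ⟨e, h⟩ else 0
      map_add' := fun w w' => by
        ext e
        by_cases h : e ∈ E <;> simp [h]
      map_smul' := fun r w => by
        ext e
        by_cases h : e ∈ E <;> simp [h] }
  let T : (E → ℝ) →ₗ[ℝ] ((A → ℝ) × (E.image Prod.snd → ℝ)) :=
    LinearMap.prod
      (LinearMap.pi fun i => ∑ j, (LinearMap.proj ((i : N), j)).comp ext)
      (LinearMap.pi fun j => ∑ i, (LinearMap.proj (i, (j : M))).comp ext)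
  have hker : LinearMap.ker T ≠ ⊥ := by
    apply LinearMap.ker_ne_bot_of_finrank_lt
    rw [Module.finrank_prod, Module.finrank_fintype_fun_eq_card,
      Module.finrank_fintype_fun_eq_card, Module.finrank_fintype_fun_eq_card, Fintype.card_coe,
      Fintype.card_coe, Fintype.card_coe]
    omega
  obtain ⟨w, hw, hw0⟩ := (Submodule.ne_bot_iff _).1 hker
  have hext0 : ∀ e, e ∉ E → ext w e = 0 := fun e he => by
    change (if h : e ∈ E then w ⟨e, h⟩ else 0) = 0
    rw [dif_neg he]
  have hext : ∀ e : E, ext w e = w e := fun e => by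
    change (if h : (e : N × M) ∈ E then w ⟨e, h⟩ else 0) = _
    rw [dif_pos e.2]
  have hcol : ∀ j, ∑ i, ext w (i, j) = 0 := by
    intro j
    by_cases hj : j ∈ E.image Prod.snd
    · have := congrFun (congrArg Prod.snd (LinearMap.mem_ker.1 hw)) ⟨j, hj⟩
      simpa [T] using this
    · exact Finset.sum_eq_zero fun i _ => hext0 _ fun h =>
        hj (Finset.mem_image_of_mem Prod.snd h)
  have hrow : ∀ i, i ≠ e₀.1 → ∑ j, ext w (i, j) = 0 := by
    intro i hi
    by_cases hiA : i ∈ E.image Prod.fst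
    · have := congrFun (congrArg Prod.fst (LinearMap.mem_ker.1 hw))
        ⟨i, Finset.mem_erase.2 ⟨hi, hiA⟩⟩
      simpa [T] using this
    · exact Finset.sum_eq_zero fun j _ => hext0 _ fun h =>
        hiA (Finset.mem_image_of_mem Prod.fst h)
  refine ⟨ext w, fun h => hw0 (funext fun e => ?_), hext0, fun i => ?_, hcol⟩
  · rw [← hext e, h]
    rfl
  · by_cases hi : i = e₀.1
    · have htot : ∑ i, ∑ j, ext w (i, j) = 0 := by
        rw [Finset.sum_comm]
        exact Finset.sum_eq_zero fun j _ => hcol j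
      rw [Finset.sum_eq_single i (fun k _ hk => hrow k (hi ▸ hk))
        fun h => absurd (Finset.mem_univ i) h] at htot
      exact htot
    · exact hrow i hi

end Forest

/-! ### EF1 assignments for prices on a forest -/

section Rounding

variable {N M : Type*} [Fintype N] [Fintype M] [DecidableEq N]

/-- The total price of the chores which the assignment `x` gives to agent `k`. -/
def earning (p : M → ℝ) (x : M → N) (k : N) : ℝ := ∑ j with x j = k, p j

/-- Envy-freeness up to one chore with respect to prices: every agent with a chore can drop one so
that the rest is worth no more than any other bundle. -/
def PriceEF1 (p : M → ℝ) (x : M → N) : Prop :=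
  ∀ b l, (∃ j, x j = b) → ∃ j, x j = b ∧ earning p x b - p j ≤ earning p x l

omit [Fintype N] in
theorem earning_update_of_ne [DecidableEq M] (p : M → ℝ) (x : M → N) (j : M) {a k : N} (ha : a ≠ k)
    (hx : x j ≠ k) : earning p (Function.update x j a) k = earning p x k := by
  unfold earning
  congr 1
  ext i
  by_cases h : i = j
  · subst h; simp [ha, hx]
  · simp [h]

omit [Fintype N] in
theorem earning_update_self [DecidableEq M] (p : M → ℝ) (x : M → N) (j : M) {a : N} (hx : x j ≠ a) :
    earning p (Function.update x j a) a = earning p x a + p j := by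
  unfold earning
  have : (Finset.univ.filter fun i => Function.update x j a i = a) =
      insert j (Finset.univ.filter fun i => x i = a) := by
    ext i
    by_cases h : i = j
    · subst h; simp
    · simp [h]
  rw [this, Finset.sum_insert (by simpa using hx), add_comm]

omit [Fintype N] in
theorem earning_update_left [DecidableEq M] (p : M → ℝ) (x : M → N) (j : M) {a : N} (ha : a ≠ x j) :
    earning p (Function.update x j a) (x j) = earning p x (x j) - p j := by
  have := earning_update_self p (Function.update x j a) j (a := x j) (by simpa using ha)
  rw [Function.update_idem, Function.update_eq_self] at this
  linarith

/-- If the admissible pairs form a forest and every agent is a least earner in some admissible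
assignment, then some admissible assignment is EF1 for the prices. The threshold is the largest
amount `t` that an agent earns from chores admissible for nobody else. As the agent attaining it is
a least earner somewhere, there are assignments with all earnings at least `t`. In such an
assignment, whoever earns more than `t` after dropping any chore may pass down a chore in the rooted
forest. When no chore can be passed down, each agent holds at most one shared chore, and dropping
it leaves at most `t`. -/
theorem exists_priceEF1_of_forest [Nonempty N] [DecidableEq M] (E : Finset (N × M))
    (hE : ∀ E' ⊆ E, E'.Nonempty → ¬ Leafless E') (p : M → ℝ) (hp : ∀ j, 0 ≤ p j)
    (hleast : ∀ i, ∃ x : M → N, (∀ j, (x j, j) ∈ E) ∧ ∀ k, earning p x i ≤ earning p x k) :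
    ∃ x : M → N, (∀ j, (x j, j) ∈ E) ∧ PriceEF1 p x := by
  obtain ⟨D, -, hD1, hD2⟩ := exists_parent_edges E hE
  set P : N → ℝ := fun k => ∑ j with ∀ i, (i, j) ∈ E → i = k, p j with hP
  obtain ⟨i₀, -, hi₀⟩ := Finset.univ.exists_max_image P Finset.univ_nonempty
  obtain ⟨x₀, hx₀, hx₀least⟩ := hleast i₀
  have hx₀P : ∀ k, P i₀ ≤ earning p x₀ k := fun k => by
    refine le_trans (Finset.sum_le_sum_of_subset_of_nonneg (fun j hj => ?_) fun j _ _ => hp j)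
      (hx₀least k)
    simp only [Finset.mem_filter, Finset.mem_univ, true_and] at hj ⊢
    exact hj _ (hx₀ j)
  classical
  obtain ⟨x, hx, hmax⟩ := (Finset.univ.filter fun x : M → N =>
    (∀ j, (x j, j) ∈ E) ∧ ∀ k, P i₀ ≤ earning p x k).exists_max_image
      (fun x => (Finset.univ.filter fun j => (x j, j) ∈ D).card)
      ⟨x₀, by simpa using ⟨hx₀, hx₀P⟩⟩
  simp only [Finset.mem_filter, Finset.mem_univ, true_and] at hx hmax
  obtain ⟨hxE, hxP⟩ := hx
  refine ⟨x, hxE, fun b l ⟨j₁, hj₁⟩ => ?_⟩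
  by_contra! hbig
  replace hbig : ∀ j, x j = b → P i₀ < earning p x b - p j := fun j hj =>
    (hxP l).trans_lt (hbig j hj)
  have hdown : ∀ j, x j = b → (∀ i, (i, j) ∈ E → i = b) ∨ (b, j) ∈ D := by
    intro j hj
    by_contra! hcon
    obtain ⟨⟨a, haE, hab⟩, hbD⟩ := hcon
    have haD : (a, j) ∈ D := by
      by_contra haD
      exact hab (congrArg Prod.fst (hD2 _ haE haD _ (hj ▸ hxE j) hbD rfl))
    have hlt : (Finset.univ.filter fun i => (x i, i) ∈ D).card <
        (Finset.univ.filter fun i => (Function.update x j a i, i) ∈ D).card := by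
      refine Finset.card_lt_card (Finset.ssubset_iff_subset_ne.2 ⟨fun i hi => ?_, fun h => ?_⟩)
      · simp only [Finset.mem_filter, Finset.mem_univ, true_and] at hi ⊢
        by_cases hij : i = j
        · subst hij
          exact absurd (hj ▸ hi) hbD
        · simpa [hij] using hi
      · have : j ∈ Finset.univ.filter fun i => (x i, i) ∈ D := by rw [h]; simpa using haD
        simp only [Finset.mem_filter, Finset.mem_univ, true_and] at this
        exact hbD (hj ▸ this)
    refine absurd (hmax (Function.update x j a) ⟨fun i => ?_, fun k => ?_⟩) (not_le.2 hlt)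
    · by_cases hij : i = j
      · subst hij
        simpa using haE
      · simpa [hij] using hxE i
    · by_cases hka : k = a
      · subst hka
        rw [earning_update_self p x j (by rw [hj]; exact hab.symm)]
        exact (hxP k).trans (le_add_of_nonneg_right (hp j))
      · by_cases hkb : k = b
        · subst hkb
          have := earning_update_left p x j (a := a) (by rw [hj]; exact hab)
          rw [hj] at this
          rw [this]
          exact (hbig j hj).le
        · rw [earning_update_of_ne p x j (Ne.symm hka) (by rw [hj]; exact Ne.symm hkb)]
          exact hxP k
  -- the chore dropped by `b` is the one shared with its parent, if there is any
  obtain ⟨j₀, hj₀, hj₀'⟩ : ∃ j₀, x j₀ = b ∧ ∀ j, x j = b → j ≠ j₀ → ∀ i, (i, j) ∈ E → i = b := by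
    by_cases h : ∃ j₀, x j₀ = b ∧ (b, j₀) ∈ D
    · obtain ⟨j₀, hj₀, hj₀D⟩ := h
      refine ⟨j₀, hj₀, fun j hj hne => (hdown j hj).resolve_right fun hjD => hne ?_⟩
      exact congrArg Prod.snd (hD1 _ hjD _ hj₀D rfl)
    · exact ⟨j₁, hj₁, fun j hj _ => (hdown j hj).resolve_right fun hjD => h ⟨j, hj, hjD⟩⟩
  refine absurd (hbig j₀ hj₀) (not_lt.2 (le_trans ?_ (hi₀ b (Finset.mem_univ b))))
  rw [earning, ← Finset.add_sum_erase _ _ (show j₀ ∈ Finset.univ.filter fun j => x j = b by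
    simpa using hj₀), add_sub_cancel_left]
  refine Finset.sum_le_sum_of_subset_of_nonneg (fun j hj => ?_) fun j _ _ => hp j
  simp only [Finset.mem_erase, Finset.mem_filter, Finset.mem_univ, true_and] at hj ⊢
  exact hj₀' j hj.2 hj.1

end Rounding

/-! ### Equilibrium weights for positive costs -/

section Generic

variable {N M : Type*} [Fintype N] [Nonempty N] [Fintype M]

/-- The largest value of `β i / c i j` over the agents `i`. Here and below positive costs are encoded
by their logarithms, `c i j = exp (-u i j)`. -/
noncomputable def bestRatio (u : N → M → ℝ) (β : stdSimplex ℝ N) (j : M) : ℝ :=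
  Finset.univ.sup' Finset.univ_nonempty fun i => β.1 i * Real.exp (u i j)

omit [Fintype M] in
theorem le_bestRatio (u : N → M → ℝ) (β : stdSimplex ℝ N) (i : N) (j : M) :
    β.1 i * Real.exp (u i j) ≤ bestRatio u β j :=
  Finset.le_sup' (fun i => β.1 i * Real.exp (u i j)) (Finset.mem_univ i)

omit [Fintype M] in
theorem exists_eq_bestRatio (u : N → M → ℝ) (β : stdSimplex ℝ N) (j : M) :
    ∃ i, β.1 i * Real.exp (u i j) = bestRatio u β j := by
  obtain ⟨i, -, h⟩ := Finset.exists_mem_eq_sup' Finset.univ_nonempty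
    fun i => β.1 i * Real.exp (u i j)
  exact ⟨i, h.symm⟩

omit [Fintype M] in
theorem bestRatio_pos (u : N → M → ℝ) (β : stdSimplex ℝ N) (j : M) : 0 < bestRatio u β j := by
  obtain ⟨i, hi⟩ : ∃ i, 0 < β.1 i := by
    by_contra! h
    have h1 := β.2.2
    have h2 : ∑ i, β.1 i ≤ 0 := Finset.sum_nonpos fun i _ => h i
    linarith
  exact (mul_pos hi (Real.exp_pos _)).trans_le (le_bestRatio u β i j)

omit [Nonempty N] [Fintype M] in
theorem continuous_ratio (i : N) (j : M) : Continuous fun q : (N → M → ℝ) × stdSimplex ℝ N =>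
    q.2.1 i * Real.exp (q.1 i j) :=
  ((continuous_apply i).comp (continuous_subtype_val.comp continuous_snd)).mul
    (Real.continuous_exp.comp ((continuous_apply j).comp ((continuous_apply i).comp continuous_fst)))

omit [Fintype M] in
theorem continuous_bestRatio (j : M) :
    Continuous fun q : (N → M → ℝ) × stdSimplex ℝ N => bestRatio q.1 q.2 j := by
  unfold bestRatio
  exact Continuous.finset_sup'_apply _ fun i _ => continuous_ratio i j

/-- The price of chore `j` for the weights `β`: the least value of `c i j / β i` over the agents `i` of
positive weight. -/
noncomputable def price (u : N → M → ℝ) (β : stdSimplex ℝ N) (j : M) : ℝ := (bestRatio u β j)⁻¹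

omit [Fintype M] in
theorem continuous_price (j : M) :
    Continuous fun q : (N → M → ℝ) × stdSimplex ℝ N => price q.1 q.2 j :=
  (continuous_bestRatio j).inv₀ fun q => (bestRatio_pos q.1 q.2 j).ne'

omit [Fintype M] in
theorem price_pos (u : N → M → ℝ) (β : stdSimplex ℝ N) (j : M) : 0 < price u β j :=
  inv_pos.2 (bestRatio_pos u β j)

/-- The assignment `x` gives every chore to an agent for whom it is cheapest at the weights `β`. -/
def Efficient (u : N → M → ℝ) (β : stdSimplex ℝ N) (x : M → N) : Prop :=
  ∀ j, β.1 (x j) * Real.exp (u (x j) j) = bestRatio u β j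

omit [Fintype M] in
theorem isClosed_efficient (x : M → N) :
    IsClosed {q : (N → M → ℝ) × stdSimplex ℝ N | Efficient q.1 q.2 x} := by
  simp only [Efficient, Set.ofPred_forall]
  exact isClosed_iInter fun j => isClosed_eq (continuous_ratio (x j) j) (continuous_bestRatio j)

variable [DecidableEq N]

theorem continuous_earning (x : M → N) (k : N) :
    Continuous fun q : (N → M → ℝ) × stdSimplex ℝ N => earning (price q.1 q.2) x k :=
  continuous_finsetSum _ fun j _ => continuous_price j

/-- There are weights at which every agent is a least earner in some efficient assignment. Indeed
the sets of weights where agent `i` can be a least earner are closed, cover the simplex, and contain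
the facet where `i` has weight zero, since `i` gets no chore there. -/
theorem exists_forall_least_earner (u : N → M → ℝ) :
    ∃ β : stdSimplex ℝ N, ∀ i, ∃ x : M → N, Efficient u β x ∧
      ∀ k, earning (price u β) x i ≤ earning (price u β) x k := by
  have hex : ∀ β, ∃ x : M → N, Efficient u β x := fun β => by
    choose x hx using exists_eq_bestRatio u β
    exact ⟨x, hx⟩
  refine exists_mem_forall_of_closed_cover (fun i => {β : stdSimplex ℝ N | ∃ x : M → N,
    Efficient u β x ∧ ∀ k, earning (price u β) x i ≤ earning (price u β) x k}) ?_ ?_ ?_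
  · intro i
    have hc : Continuous fun β : stdSimplex ℝ N => (u, β) := Continuous.prodMk_right u
    have he : ∀ (x : M → N) k, Continuous fun β => earning (price u β) x k := fun x k =>
      (continuous_earning x k).comp hc
    rw [Set.ofPred_exists]
    refine isClosed_iUnion_of_finite fun x => IsClosed.and ((isClosed_efficient x).preimage hc) ?_
    rw [Set.ofPred_forall]
    exact isClosed_iInter fun k => isClosed_le (he x i) (he x k)
  · intro β
    obtain ⟨x, hx⟩ := hex β
    obtain ⟨i, -, hi⟩ := Finset.univ.exists_min_image (earning (price u β) x)
      Finset.univ_nonempty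
    exact ⟨i, x, hx, fun k => hi k (Finset.mem_univ k)⟩
  · intro i β hi
    obtain ⟨x, hx⟩ := hex β
    refine ⟨x, hx, fun k => ?_⟩
    have h0 : earning (price u β) x i = 0 := by
      unfold earning
      rw [Finset.filter_eq_empty_iff.2, Finset.sum_empty]
      intro j _ hj
      have := bestRatio_pos u β j
      rw [← hx j, hj, hi, zero_mul] at this
      exact lt_irrefl _ this
    rw [h0]
    exact Finset.sum_nonneg fun j _ => (price_pos u β j).le

/-- The pairs `(i, j)` for which chore `j` may go to agent `i` in an efficient assignment. -/
noncomputable def tightPairs [DecidableEq M] (u : N → M → ℝ) (β : stdSimplex ℝ N) :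
    Finset (N × M) :=
  Finset.univ.filter fun e => β.1 e.1 * Real.exp (u e.1 e.2) = bestRatio u β e.2

/-- For all costs outside finitely many hyperplanes (in logarithmic coordinates), the tight pairs
form a forest at any weights: around a circulation `z` supported on tight pairs, the equations
`u i j = log (bestRatio u β j) - log (β i)` give `∑ z (i, j) * u i j = 0`. -/
theorem dense_forest [DecidableEq M] :
    Dense {u : N → M → ℝ | ∀ β, ∀ E ⊆ tightPairs u β, E.Nonempty → ¬ Leafless E} := by
  have hz : ∀ E : {E : Finset (N × M) // Leafless E ∧ E.Nonempty}, ∃ z : N × M → ℝ, z ≠ 0 ∧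
      (∀ e, e ∉ E.1 → z e = 0) ∧ (∀ i, ∑ j, z (i, j) = 0) ∧ ∀ j, ∑ i, z (i, j) = 0 :=
    fun E => E.2.1.exists_circulation E.2.2
  choose z hz0 hzE hzrow hzcol using hz
  let ℓ : {E : Finset (N × M) // Leafless E ∧ E.Nonempty} → (N → M → ℝ) →ₗ[ℝ] ℝ := fun E =>
    ∑ i, ∑ j, z E (i, j) • (LinearMap.proj (R := ℝ) (φ := fun _ : M => ℝ) j).comp
      (LinearMap.proj (φ := fun _ : N => M → ℝ) i)
  have hℓ : ∀ E u, ℓ E u = ∑ i, ∑ j, z E (i, j) * u i j := fun E u => by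
    simp [ℓ, LinearMap.sum_apply]
  have hdense : Dense (⋂ E, ((LinearMap.ker (ℓ E) : Set (N → M → ℝ)))ᶜ) := by
    refine dense_iInter_of_isOpen (fun E => ?_) fun E => ?_
    · exact (Submodule.closed_of_finiteDimensional _).isOpen_compl
    · rw [← interior_eq_empty_iff_dense_compl, ← Set.not_nonempty_iff_eq_empty]
      intro hne
      have htop := Submodule.eq_top_of_nonempty_interior' _ hne
      refine hz0 E (funext fun e => ?_)
      have h := hℓ E fun i j => if (i, j) = e then 1 else 0
      rw [LinearMap.mem_ker.1 (htop ▸ Submodule.mem_top), ← Finset.sum_product'] at h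
      simpa using h.symm
  refine hdense.mono fun u hu β E hE hne hleaf => ?_
  refine Set.mem_iInter.1 hu ⟨E, hleaf, hne⟩ (LinearMap.mem_ker.2 ?_)
  set E' : {E : Finset (N × M) // Leafless E ∧ E.Nonempty} := ⟨E, hleaf, hne⟩
  have hterm : ∀ i j, z E' (i, j) * u i j =
      z E' (i, j) * Real.log (bestRatio u β j) - z E' (i, j) * Real.log (β.1 i) := by
    intro i j
    by_cases he : (i, j) ∈ E
    · have ht : β.1 i * Real.exp (u i j) = bestRatio u β j := by
        simpa [tightPairs] using hE he
      have hpos := bestRatio_pos u β j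
      have hβ : β.1 i ≠ 0 := fun h => by
        rw [← ht, h, zero_mul] at hpos
        exact lt_irrefl _ hpos
      rw [← ht, Real.log_mul hβ (Real.exp_pos _).ne', Real.log_exp]
      ring
    · rw [hzE E' _ he]
      ring
  rw [hℓ]
  simp only [hterm, Finset.sum_sub_distrib]
  rw [Finset.sum_comm]
  simp only [← Finset.sum_mul, hzcol, hzrow, zero_mul, Finset.sum_const_zero, sub_zero]

/-- For all positive costs there are weights and an efficient assignment which is EF1 for the
prices. For generic costs this follows from the rounding of a common point; as weights vary in a
compact set, the costs with this property form a closed set. -/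
theorem exists_efficient_priceEF1 (u : N → M → ℝ) :
    ∃ (β : stdSimplex ℝ N) (x : M → N), Efficient u β x ∧ PriceEF1 (price u β) x := by
  classical
  set Z := {q : (N → M → ℝ) × stdSimplex ℝ N | ∃ x : M → N, Efficient q.1 q.2 x ∧
    PriceEF1 (price q.1 q.2) x} with hZ
  have hZc : IsClosed Z := by
    rw [hZ, Set.ofPred_exists]
    refine isClosed_iUnion_of_finite fun x => IsClosed.and (isClosed_efficient x) ?_
    rw [show {q : (N → M → ℝ) × stdSimplex ℝ N | PriceEF1 (price q.1 q.2) x} =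
      ⋂ b, ⋂ l, ⋂ (_ : ∃ j, x j = b), ⋃ j, {q | x j = b ∧
        earning (price q.1 q.2) x b - price q.1 q.2 j ≤ earning (price q.1 q.2) x l} by
      ext q
      simp only [PriceEF1, Set.mem_iInter, Set.mem_iUnion, Set.mem_ofPred_eq]]
    refine isClosed_iInter fun b => isClosed_iInter fun l => isClosed_iInter fun _ =>
      isClosed_iUnion_of_finite fun j => IsClosed.and isClosed_const ?_
    exact isClosed_le ((continuous_earning x b).sub (continuous_price j)) (continuous_earning x l)
  have himg : IsClosed (Prod.fst '' Z) := isClosedMap_fst_of_compactSpace _ hZc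
  have hdense : Dense (Prod.fst '' Z) := by
    refine dense_forest.mono fun u hu => ?_
    obtain ⟨β, hβ⟩ := exists_forall_least_earner u
    have heff : ∀ x : M → N, Efficient u β x ↔ ∀ j, (x j, j) ∈ tightPairs u β := fun x => by
      simp [Efficient, tightPairs]
    obtain ⟨x, hx, hEF1⟩ := exists_priceEF1_of_forest (tightPairs u β) (hu β) (price u β)
      (fun j => (price_pos u β j).le) fun i => by
        obtain ⟨x, hx, hle⟩ := hβ i
        exact ⟨x, (heff x).1 hx, hle⟩
    exact ⟨(u, β), ⟨x, (heff x).2 hx, hEF1⟩, rfl⟩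
  have hu : u ∈ Prod.fst '' Z := by
    rw [← himg.closure_eq, hdense.closure_eq]
    exact Set.mem_univ u
  obtain ⟨⟨u', β⟩, ⟨x, hx⟩, rfl⟩ := hu
  exact ⟨β, x, hx⟩

end Generic

/-! ### Nonnegative costs and the allocation -/

section Certificate

variable {N M : Type*} [Fintype N] [Nonempty N] [Fintype M] [DecidableEq N]

/-- For nonnegative costs `c i j` there are weights `β i`, prices `P j` and an assignment `f` such
that every chore goes to an agent for whom it is cheapest at the weights, and `f` is EF1 for the
prices. Chores without cost for somebody have price zero and go to such an agent. -/
theorem exists_equilibrium (c : N → M → ℝ) (hc : ∀ i j, 0 ≤ c i j) :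
    ∃ (β : N → ℝ) (P : M → ℝ) (f : M → N), (∀ i, 0 ≤ β i) ∧ (∀ j, 0 ≤ P j) ∧
      (∀ i j, β i * P j ≤ c i j) ∧ (∀ j, β (f j) * P j = c (f j) j) ∧
      (∀ i j, 0 < P j → 0 < c i j) ∧
      ∀ b l, (∃ j, f j = b ∧ 0 < P j) →
        ∃ j, f j = b ∧ earning P f b - P j ≤ earning P f l := by
  classical
  set u : N → {j // ∀ i, 0 < c i j} → ℝ := fun i j => -Real.log (c i j) with hu
  obtain ⟨β, x, hx, hEF1⟩ := exists_efficient_priceEF1 u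
  have hexp : ∀ i (j : {j // ∀ i, 0 < c i j}), Real.exp (u i j) = (c i j)⁻¹ := fun i j => by
    rw [hu, Real.exp_neg, Real.exp_log (j.2 i)]
  have hzero : ∀ j, (¬ ∀ i, 0 < c i j) → ∃ i, c i j = 0 := fun j hj => by
    push Not at hj
    obtain ⟨i, hi⟩ := hj
    exact ⟨i, le_antisymm hi (hc i j)⟩
  choose g hg using hzero
  set P : M → ℝ := fun j => if h : ∀ i, 0 < c i j then price u β ⟨j, h⟩ else 0 with hP
  set f : M → N := fun j => if h : ∀ i, 0 < c i j then x ⟨j, h⟩ else g j h with hf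
  have hPpos : ∀ j (h : ∀ i, 0 < c i j), P j = price u β ⟨j, h⟩ := fun j h => dif_pos h
  have hPzero : ∀ j, (¬ ∀ i, 0 < c i j) → P j = 0 := fun j h => dif_neg h
  have hfpos : ∀ j (h : ∀ i, 0 < c i j), f j = x ⟨j, h⟩ := fun j h => dif_pos h
  have hfzero : ∀ j h, f j = g j h := fun j h => dif_neg h
  have hearn : ∀ k, earning P f k = earning (price u β) x k := by
    intro k
    unfold earning
    rw [← Finset.sum_filter_add_sum_filter_not _ (fun j => ∀ i, 0 < c i j),
      Finset.sum_eq_zero (s := Finset.filter _ _) fun j hj => hPzero j (Finset.mem_filter.1 hj).2,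
      add_zero]
    symm
    refine Finset.sum_bij (fun j _ => j.1) ?_ ?_ ?_ ?_
    · intro j hj
      simp only [Finset.mem_filter, Finset.mem_univ, true_and] at hj ⊢
      exact ⟨by rw [hfpos j.1 j.2]; exact hj, j.2⟩
    · exact fun j _ j' _ h => Subtype.ext h
    · intro j hj
      simp only [Finset.mem_filter, Finset.mem_univ, true_and] at hj
      exact ⟨⟨j, hj.2⟩, by simpa [← hfpos j hj.2] using hj.1, rfl⟩
    · exact fun j _ => (hPpos j.1 j.2).symm
  have hPpos' : ∀ j, 0 < P j → ∀ i, 0 < c i j := fun j hj => by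
    by_contra h
    exact hj.ne' (hPzero j h)
  refine ⟨β.1, P, f, β.2.1, fun j => ?_, fun i j => ?_, fun j => ?_,
    fun i j h => hPpos' j h i, fun b l hb => ?_⟩
  · by_cases h : ∀ i, 0 < c i j
    · rw [hPpos j h]
      exact (price_pos u β _).le
    · exact (hPzero j h).ge
  · by_cases h : ∀ i, 0 < c i j
    · have := le_bestRatio u β i ⟨j, h⟩
      rw [hexp, ← div_eq_mul_inv, div_le_iff₀ (h i)] at this
      rw [hPpos j h, price, ← div_eq_mul_inv, div_le_iff₀ (bestRatio_pos u β _), mul_comm]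
      exact this
    · rw [hPzero j h, mul_zero]
      exact hc i j
  · by_cases h : ∀ i, 0 < c i j
    · have := hx ⟨j, h⟩
      rw [hexp, ← div_eq_mul_inv, div_eq_iff (h _).ne'] at this
      rw [hPpos j h, hfpos j h, price, ← div_eq_mul_inv, div_eq_iff (bestRatio_pos u β _).ne',
        mul_comm]
      exact this
    · rw [hPzero j h, mul_zero, hfzero j h, hg]
  · obtain ⟨j, hjb, hj⟩ := hb
    have hj := hPpos' j hj
    obtain ⟨⟨j', hj'⟩, hj'b, hle⟩ := hEF1 b l ⟨⟨j, hj⟩, by rw [← hfpos j hj, hjb]⟩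
    refine ⟨j', by rw [hfpos j' hj', hj'b], ?_⟩
    rw [hearn, hearn, hPpos j' hj']
    exact hle

end Certificate

theorem theorem2 {N M : Type*} [Fintype N] [Nonempty N] [Fintype M] [DecidableEq M]
    (I : FairDivision.ChoreInstance N M) :
    ∃ x : FairDivision.Allocation N M, I.IsEF1 x ∧ I.IsFPO x := by
  classical
  obtain ⟨β, P, f, hβ, hP, hle, heq, hpos, hEF1⟩ :=
    exists_equilibrium (fun i j => I.cost i {j}) fun i j => I.cost_nonneg i {j}
  have hcost : ∀ i k, β i * earning P f k ≤ I.cost i (Finset.univ.filter fun j => f j = k) := by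
    intro i k
    rw [I.cost_additive, earning, Finset.mul_sum]
    exact Finset.sum_le_sum fun j _ => hle i j
  have hown : ∀ i, I.cost i (Finset.univ.filter fun j => f j = i) = β i * earning P f i := by
    intro i
    rw [I.cost_additive, earning, Finset.mul_sum]
    refine Finset.sum_congr rfl fun j hj => ?_
    have hj := (Finset.mem_filter.1 hj).2
    exact hj ▸ (heq j).symm
  refine ⟨⟨fun i => Finset.univ.filter fun j => f j = i, fun i i' hii => ?_,
    fun j => ⟨f j, by simp⟩⟩, fun i i' henvy => ?_, ?_⟩
  · rw [Finset.disjoint_filter]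
    exact fun j _ h h' => hii (h.symm.trans h')
  · simp only [FairDivision.ChoreInstance.Envies] at henvy ⊢
    have hcpos := (I.cost_nonneg i _).trans_lt henvy
    rw [hown] at hcpos
    have hepos : 0 < earning P f i := pos_of_mul_pos_right hcpos (hβ i)
    obtain ⟨j, hj, hj0⟩ := Finset.exists_lt_of_sum_lt (s := Finset.univ.filter fun j => f j = i)
      (f := fun _ => (0 : ℝ)) (g := P) (by rw [Finset.sum_const_zero]; exact hepos)
    obtain ⟨j, hj, hjle⟩ := hEF1 i i' ⟨j, (Finset.mem_filter.1 hj).2, hj0⟩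
    have hjm : j ∈ Finset.univ.filter fun j => f j = i := by simpa using hj
    refine ⟨j, hjm, ?_⟩
    have hsplit : I.cost i ((Finset.univ.filter fun j => f j = i) \ {j}) =
        β i * (earning P f i - P j) := by
      have h1 := hown i
      rw [I.cost_additive, ← Finset.add_sum_erase _ _ hjm, ← Finset.sdiff_singleton_eq_erase,
        ← I.cost_additive] at h1
      have h2 := heq j
      rw [hj] at h2
      rw [mul_sub, ← h1, h2]
      ring
    rw [hsplit]
    exact (mul_le_mul_of_nonneg_left hjle (hβ i)).trans (hcost i i')
  · rintro ⟨y, hyle, i₁, hlt⟩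
    simp only [hown] at hyle hlt
    have hy : ∀ i, β i * ∑ j, y.share i j * P j ≤ I.fractionalCost y i := fun i => by
      rw [FairDivision.ChoreInstance.fractionalCost, Finset.mul_sum]
      refine Finset.sum_le_sum fun j _ => ?_
      rw [mul_left_comm]
      exact mul_le_mul_of_nonneg_left (hle i j) (y.share_nonneg i j)
    have hterm : ∀ i j, 0 ≤ y.share i j * I.cost i {j} := fun i j =>
      mul_nonneg (y.share_nonneg i j) (I.cost_nonneg i {j})
    have hearn : ∀ i, ∑ j, y.share i j * P j ≤ earning P f i := by
      intro i
      rcases (hβ i).eq_or_lt with h0 | h0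
      -- an agent of weight zero has cost zero, so she takes no part of a chore with a price
      · have hyi := hyle i
        rw [← h0, zero_mul] at hyi
        have hall := (Finset.sum_eq_zero_iff_of_nonneg fun j _ => hterm i j).1
          (le_antisymm hyi (Finset.sum_nonneg fun j _ => hterm i j))
        rw [Finset.sum_eq_zero]
        · exact Finset.sum_nonneg fun j _ => hP j
        · intro j hj
          rcases (hP j).eq_or_lt with hj0 | hj0
          · rw [← hj0, mul_zero]
          · rw [(mul_eq_zero.1 (hall j hj)).resolve_right (hpos i j hj0).ne', zero_mul]
      · exact le_of_mul_le_mul_left ((hy i).trans (hyle i)) h0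
    have hearn' : ∑ j, y.share i₁ j * P j < earning P f i₁ :=
      lt_of_mul_lt_mul_left ((hy i₁).trans_lt hlt) (hβ i₁)
    have hlt' := Finset.sum_lt_sum (fun i _ => hearn i) ⟨i₁, Finset.mem_univ _, hearn'⟩
    have hsum : ∑ i, earning P f i = ∑ j, P j := Finset.sum_fiberwise _ f P
    rw [Finset.sum_comm, hsum] at hlt'
    simp only [← Finset.sum_mul, y.share_sum, one_mul, lt_irrefl] at hlt'
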